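/- Let $q>0$, $q\neq 1$, let $0\le R_1<R_2\le+\infty$ and let $M,N\in\mathbb{R}$ be such that $M+N\ln r>0$ for all $r\in(R_1,R_2)$. On the annular domain $\Omega=\{x\in\mathbb{R}^2: R_1<|x|<R_2\}$ consider, for $\varepsilon=\pm1$, the equation $$\Delta u=\varepsilon\,|x|^{-2}\,(M+N\ln|x|)^{1-q}\,u|u|^{q-1}.\qquad (*)$$ A solution is a function $u\in C^2(\Omega)$ satisfying $(*)$ in $\Omega$. It is called pseudo-radial if in polar coordinates $u(r,\theta)=h(r)w(\theta)$ for some functions $h$ on $(R_1,R_2)$ and some $2\pi$-periodic function $w$, and radial if it depends only on $|x|$. 1. If $\varepsilon=+1$, then every pseudo-radial solution of $(*)$ is radial. 2. Let $\varepsilon=-1$. For every integer $k\ge1$ the ordinary differential equation $$w''=-w|w|^{q-1}\quad\text{on }\mathbb{R}$$ has a sign-changing $C^2$ solution $w_k$ of least period $2\pi/k$ with $w_k(0)=0$. It is unique up to sign among the sign-changing solutions of least period $2\pi/k$ that vanish at $0$; every sign-changing solution of least period $2\pi/k$ is of the form $\pm w_k(\cdot-\varphi)$ with $\varphi\in\mathbb{R}$.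 The non-radial pseudo-radial solutions of $(*)$ are exactly the functions $$u(r,\theta)=\pm(M+N\ln r)\,w_k(\theta-\varphi),\qquad k\ge1,\ \varphi\in\mathbb{R},$$ that is, up to rotation, the functions $\pm(M+N\ln|x|)\,w_k(\theta)$, $k\ge 1$; the integer $k$ is determined by $u$. -/

import Mathlib

noncomputable section

namespace PseudoRadial

/-- The Euclidean plane. -/
abbrev Plane : Type := EuclideanSpace ℝ (Fin 2)

/-- The point with polar coordinates `(r, θ)`. -/
def polar (r θ : ℝ) : Plane := !₂[r * Real.cos θ, r * Real.sin θ]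

/-- The annular domain `{R₁ < |x| < R₂}`, where `R₂ = +∞` is allowed. -/
def annulus (R₁ : ℝ) (R₂ : EReal) : Set Plane :=
  {x | R₁ < ‖x‖ ∧ ((‖x‖ : ℝ) : EReal) < R₂}

/-- `u` is a classical (`C²`) solution in `{R₁ < |x| < R₂}` of
`Δ u = ε |x|⁻² (M + N ln |x|) ^ (1 - q) u |u| ^ (q - 1)`. -/
def IsSolution (R₁ : ℝ) (R₂ : EReal) (M N ε q : ℝ) (u : Plane → ℝ) : Prop :=
  ContDiffOn ℝ 2 u (annulus R₁ R₂) ∧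
    ∀ x ∈ annulus R₁ R₂,
      Laplacian.laplacian u x =
        ε * (‖x‖ ^ 2)⁻¹ * (M + N * Real.log ‖x‖) ^ (1 - q) * (u x * |u x| ^ (q - 1))

/-- In polar coordinates `u(r, θ) = h(r) w(θ)`, with `w` a function on the circle. -/
def IsPseudoRadial (R₁ : ℝ) (R₂ : EReal) (u : Plane → ℝ) : Prop :=
  ∃ h w : ℝ → ℝ, Function.Periodic w (2 * Real.pi) ∧
    ∀ r θ : ℝ, R₁ < r → (r : EReal) < R₂ → u (polar r θ) = h r * w θ

/-- `u` depends only on `|x|` in the annulus. -/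
def IsRadial (R₁ : ℝ) (R₂ : EReal) (u : Plane → ℝ) : Prop :=
  ∀ x ∈ annulus R₁ R₂, ∀ y ∈ annulus R₁ R₂, ‖x‖ = ‖y‖ → u x = u y

/-- `w` is a `C²` solution on `ℝ` of `w'' + μ w = ε w |w| ^ (q - 1)`. -/
def IsODESolution (μ ε q : ℝ) (w : ℝ → ℝ) : Prop :=
  ContDiff ℝ 2 w ∧
    ∀ θ, deriv (deriv w) θ + μ * w θ = ε * (w θ * |w θ| ^ (q - 1))

/-- `w` takes both positive and negative values. -/
def IsSignChanging (w : ℝ → ℝ) : Prop :=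
  (∃ θ, 0 < w θ) ∧ ∃ θ, w θ < 0

/-- `T` is the least positive period of `w`. -/
def HasLeastPeriod (w : ℝ → ℝ) (T : ℝ) : Prop :=
  IsLeast {S : ℝ | 0 < S ∧ Function.Periodic w S} T

/-- `w` is a sign-changing solution, of least period `2π / k`, of the equation
`w'' + μ w = ε w |w| ^ (q - 1)` with `μ = 0` and `ε = -1`. -/
def IsAngularMode (q : ℝ) (k : ℕ) (w : ℝ → ℝ) : Prop :=
  IsODESolution 0 (-1) q w ∧ IsSignChanging w ∧ HasLeastPeriod w (2 * Real.pi / k)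

/-- On the annulus, `u(r, θ) = ± (M + N ln r) w(θ - φ)` for some sign and some rotation
angle `φ`. -/
def IsRotatedProfile (R₁ : ℝ) (R₂ : EReal) (M N : ℝ) (w : ℝ → ℝ) (u : Plane → ℝ) : Prop :=
  ∃ s φ : ℝ, (s = 1 ∨ s = -1) ∧
    ∀ r θ : ℝ, R₁ < r → (r : EReal) < R₂ →
      u (polar r θ) = s * ((M + N * Real.log r) * w (θ - φ))

end PseudoRadial

end

noncomputable section

open Set Filter Topology MeasureTheory

/-! In the variable `t = log r` one has `r² Δ = ∂ₜ² + ∂_θ²`, so the factor `|x|⁻²` disappears and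
the weight becomes a power of the affine function `p(t) = M + N t`. Write a non-radial pseudo-radial
solution as `f(t) w(θ)`, with `w` non-constant. Comparing the equation at two angles eliminates
`f''` and shows that `(|f| / p) ^ (q - 1)` is constant where `f ≠ 0`; since `q ≠ 1`, connectedness
gives `f = c p` (`radial_factor_of_separation`). Then `f'' = 0`, the right-hand side is homogeneous
of degree one in `p`, and `W = c w` solves `W'' = ε W |W| ^ (q - 1)`.

For `ε = 1`, `(W W')' ≥ 0` and periodicity force `W` to be constant (`const_of_periodic_pos`). For
`ε = -1`, a periodic nonzero `W` changes sign (`signChanging_of_periodic`), hence has a zero. The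
equation has an explicit periodic solution `S` (`exists_generalizedSine`) and a scaling symmetry.
Uniqueness of the Cauchy problem at a zero (`solution_unique`) makes `W` a signed translate of a
dilation of `S` (`exists_eq_rescale`), and the period `2π` selects the dilation factors `k T /
(2π)`.

When `q < 1` the nonlinearity is not Lipschitz at `0`; there uniqueness comes from the conserved
energy (`eventuallyEq_of_deriv_pos`). -/

namespace PseudoRadial

/-! ### Odd powers -/

/-- The odd power function `x ↦ x |x| ^ (p - 1)`. -/
def signedPow (p x : ℝ) : ℝ := x * |x| ^ (p - 1)

@[simp] theorem signedPow_zero (p : ℝ) : signedPow p 0 = 0 := by simp [signedPow]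

theorem signedPow_neg (p x : ℝ) : signedPow p (-x) = -signedPow p x := by simp [signedPow]

theorem abs_signedPow {p : ℝ} (hp : 0 < p) (x : ℝ) : |signedPow p x| = |x| ^ p := by
  rcases eq_or_ne x 0 with rfl | hx
  · simp [hp.ne']
  · have h : 0 < |x| := abs_pos.2 hx
    rw [signedPow, abs_mul, abs_of_nonneg (Real.rpow_nonneg h.le _), Real.rpow_sub_one h.ne']
    field_simp

theorem signedPow_pos {p x : ℝ} (hx : 0 < x) : 0 < signedPow p x :=
  mul_pos hx (Real.rpow_pos_of_pos (abs_pos.2 hx.ne') _)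

theorem signedPow_of_pos {p x : ℝ} (hx : 0 < x) : signedPow p x = x ^ p := by
  rw [signedPow, abs_of_pos hx, Real.rpow_sub_one hx.ne']
  field_simp

theorem signedPow_mul (p x y : ℝ) : signedPow p (x * y) = signedPow p x * signedPow p y := by
  simp only [signedPow, abs_mul, Real.mul_rpow (abs_nonneg x) (abs_nonneg y)]
  ring

theorem mul_signedPow_nonneg (p x : ℝ) : 0 ≤ x * signedPow p x := by
  have : x * signedPow p x = x ^ 2 * |x| ^ (p - 1) := by rw [signedPow]; ring
  rw [this]; positivity

theorem signedPow_eq_zero {p x : ℝ} : signedPow p x = 0 ↔ x = 0 := by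
  refine ⟨fun h => ?_, fun h => by simp [h]⟩
  by_contra hx
  exact (mul_ne_zero hx (Real.rpow_pos_of_pos (abs_pos.2 hx) _).ne') h

theorem contDiffAt_signedPow (p : ℝ) {x : ℝ} (hx : x ≠ 0) :
    ContDiffAt ℝ 1 (signedPow p) x := by
  unfold signedPow
  exact contDiffAt_id.mul ((contDiffAt_abs hx).rpow_const_of_ne (abs_pos.2 hx).ne')

theorem continuous_signedPow {p : ℝ} (hp : 0 < p) : Continuous (signedPow p) := by
  refine continuous_iff_continuousAt.2 fun x => ?_
  rcases eq_or_ne x 0 with rfl | hx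
  · rw [ContinuousAt, signedPow_zero]
    refine squeeze_zero_norm (a := fun x => |x| ^ p)
      (fun y => by rw [Real.norm_eq_abs, abs_signedPow hp]) ?_
    have : Continuous fun x : ℝ => |x| ^ p := continuous_abs.rpow_const fun _ => Or.inr hp.le
    simpa [hp.ne'] using this.tendsto 0
  · exact (contDiffAt_signedPow p hx).continuousAt

theorem hasDerivAt_signedPow (p : ℝ) {x : ℝ} (hx : x ≠ 0) :
    HasDerivAt (signedPow p) (p * |x| ^ (p - 1)) x := by
  have h := (hasDerivAt_id x).mul ((hasDerivAt_abs hx).rpow_const (p := p - 1)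
    (Or.inl (abs_pos.2 hx).ne'))
  refine h.congr_deriv ?_
  have h1 : x * (SignType.sign x : ℝ) = |x| := by
    rcases lt_or_gt_of_ne hx with h | h
    · simp [sign_neg h, abs_of_neg h]
    · simp [sign_pos h, abs_of_pos h]
  have h2 : |x| ^ (p - 1 - 1) * |x| = |x| ^ (p - 1) := by
    rw [Real.rpow_sub_one (abs_pos.2 hx).ne']
    field_simp [(abs_pos.2 hx).ne']
  simp only [id]
  linear_combination (p - 1) * |x| ^ (p - 1 - 1) * h1 + (p - 1) * h2

/-- The potential of the nonlinearity `signedPow q`, up to the factor `q + 1`. -/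
theorem hasDerivAt_abs_rpow_add_one {q : ℝ} (hq : 0 < q) (x : ℝ) :
    HasDerivAt (fun x : ℝ => |x| ^ (q + 1)) ((q + 1) * signedPow q x) x := by
  refine (hasDerivAt_abs_rpow x (by linarith : 1 < q + 1)).congr_deriv ?_
  rw [signedPow, show q + 1 - 2 = q - 1 by ring]
  ring

/-! ### The arc-time function -/

theorem countable_sin_eq_zero : {s : ℝ | Real.sin s = 0}.Countable := by
  refine (countable_range fun n : ℤ => (n : ℝ) * Real.pi).mono fun s hs => ?_
  obtain ⟨n, hn⟩ := Real.sin_eq_zero_iff.1 hs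
  exact ⟨n, hn⟩

theorem periodic_abs_sin_rpow (b : ℝ) :
    Function.Periodic (fun s => |Real.sin s| ^ b) Real.pi := fun s => by
  simp [Real.sin_add_pi]

/-- For `b < 0`, Jordan's inequality `sin s ≥ 2 s / π` on `[0, π/2]` bounds the singularity at `0`
by a multiple of `s ^ b`. Reflection in `π/2` and `π`-periodicity carry this to every interval. -/
theorem intervalIntegrable_abs_sin_rpow {b : ℝ} (hb : -1 < b) (x y : ℝ) :
    IntervalIntegrable (fun s => |Real.sin s| ^ b) volume x y := by
  rcases le_or_gt 0 b with h0 | h0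
  · exact (Real.continuous_sin.abs.rpow_const fun _ => Or.inr h0).intervalIntegrable _ _
  have hm : Measurable fun s => |Real.sin s| ^ b := by fun_prop
  have h1 : IntervalIntegrable (fun s => |Real.sin s| ^ b) volume 0 (Real.pi / 2) := by
    refine ((intervalIntegral.intervalIntegrable_rpow' (a := 0) (b := Real.pi / 2)
      hb).const_mul ((2 / Real.pi) ^ b)).mono_fun hm.aestronglyMeasurable ?_
    refine (ae_restrict_iff' measurableSet_uIoc).2 (Eventually.of_forall fun s hs => ?_)
    rw [uIoc_of_le (by positivity)] at hs
    have h2 := Real.mul_le_sin hs.1.le hs.2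
    have h3 : 0 < 2 / Real.pi := by positivity
    have h4 : 0 < 2 / Real.pi * s := mul_pos h3 hs.1
    have h5 := hs.1
    beta_reduce
    rw [Real.norm_of_nonneg (by positivity), ← Real.mul_rpow h3.le hs.1.le,
      Real.norm_of_nonneg (by positivity), abs_of_pos (h4.trans_le h2)]
    exact Real.rpow_le_rpow_of_nonpos h4 h2 h0.le
  have h2 : IntervalIntegrable (fun s => |Real.sin s| ^ b) volume (Real.pi / 2) Real.pi := by
    have := (h1.comp_sub_left Real.pi).symm
    simp only [Real.sin_pi_sub, sub_zero] at this
    convert this using 1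
    ring
  exact (periodic_abs_sin_rpow b).intervalIntegrable₀ Real.pi_ne_zero (h1.trans h2) x y

theorem integral_abs_sin_rpow_pos {b : ℝ} (hb : -1 < b) {x y : ℝ} (hxy : x < y) :
    0 < ∫ s in x..y, |Real.sin s| ^ b := by
  rw [intervalIntegral.integral_pos_iff_support_of_nonneg_ae
    (Eventually.of_forall fun s => by positivity) (intervalIntegrable_abs_sin_rpow hb x y)]
  refine ⟨hxy, ?_⟩
  have h : Ioc x y \ {s | Real.sin s = 0} ⊆
      Function.support (fun s => |Real.sin s| ^ b) ∩ Ioc x y := fun s hs =>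
    ⟨(Real.rpow_pos_of_pos (abs_pos.2 hs.2) _).ne', hs.1⟩
  refine lt_of_lt_of_le ?_ (measure_mono h)
  rw [measure_sdiff_null (countable_sin_eq_zero.measure_zero _), Real.volume_Ioc]
  simpa using hxy

/-- The time needed to reach the phase `s`. -/
def arcTime (b s : ℝ) : ℝ := ∫ x in (0 : ℝ)..s, |Real.sin x| ^ b

theorem arcTime_strictMono {b : ℝ} (hb : -1 < b) : StrictMono (arcTime b) := fun x y hxy => by
  have := intervalIntegral.integral_add_adjacent_intervals
    (intervalIntegrable_abs_sin_rpow hb 0 x) (intervalIntegrable_abs_sin_rpow hb x y)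
  have h2 := integral_abs_sin_rpow_pos hb hxy
  simp only [arcTime]
  linarith

theorem arcTime_surjective {b : ℝ} (hb : -1 < b) : Function.Surjective (arcTime b) := by
  refine Continuous.surjective
    (intervalIntegral.continuous_primitive (intervalIntegrable_abs_sin_rpow hb) 0) ?_ ?_
  · exact (periodic_abs_sin_rpow b).tendsto_atTop_intervalIntegral_of_pos
      (integral_abs_sin_rpow_pos hb Real.pi_pos) Real.pi_pos
  · exact (periodic_abs_sin_rpow b).tendsto_atBot_intervalIntegral_of_pos
      (integral_abs_sin_rpow_pos hb Real.pi_pos) Real.pi_pos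

theorem arcTime_zero (b : ℝ) : arcTime b 0 = 0 := by simp [arcTime]

theorem arcTime_add_two_pi {b : ℝ} (hb : -1 < b) (s : ℝ) :
    arcTime b (s + 2 * Real.pi) = arcTime b s + arcTime b (2 * Real.pi) := by
  have hp : Function.Periodic (fun s => |Real.sin s| ^ b) (2 * Real.pi) := fun s => by simp
  have := hp.intervalIntegral_add_eq_add 0 s (fun x y => intervalIntegrable_abs_sin_rpow hb x y)
  simpa [arcTime] using this

theorem arcTime_nat_mul {b : ℝ} (hb : -1 < b) (k : ℕ) :
    arcTime b (k * (2 * Real.pi)) = k * arcTime b (2 * Real.pi) := by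
  induction k with
  | zero => simp [arcTime_zero]
  | succ k ih => push_cast; rw [add_mul, one_mul, arcTime_add_two_pi hb, ih]; ring

theorem hasDerivAt_arcTime {b : ℝ} (hb : -1 < b) {s : ℝ} (hs : Real.sin s ≠ 0) :
    HasDerivAt (arcTime b) (|Real.sin s| ^ b) s := by
  have hm : Measurable fun s => |Real.sin s| ^ b := by fun_prop
  refine intervalIntegral.integral_hasDerivAt_right (intervalIntegrable_abs_sin_rpow hb 0 s)
    hm.stronglyMeasurable.stronglyMeasurableAtFilter ?_
  exact Real.continuous_sin.continuousAt.abs.rpow_const (Or.inl (abs_pos.2 hs).ne')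

/-- There is a strictly increasing continuous phase whose speed is `|sin| ^ (-b)`. -/
theorem exists_phase {b : ℝ} (hb : -1 < b) :
    ∃ ψ : ℝ → ℝ, ∃ T : ℝ, 0 < T ∧ StrictMono ψ ∧ Continuous ψ ∧ Function.Surjective ψ ∧
      ψ 0 = 0 ∧ (∀ t, ψ (t + T) = ψ t + 2 * Real.pi) ∧
      (∀ k : ℕ, ψ (k * T) = k * (2 * Real.pi)) ∧
      ∀ t, Real.sin (ψ t) ≠ 0 → HasDerivAt ψ (|Real.sin (ψ t)| ^ (-b)) t := by
  let e := (arcTime_strictMono hb).orderIsoOfSurjective _ (arcTime_surjective hb)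
  have he : ∀ s, e s = arcTime b s := fun s => rfl
  have hcont : Continuous e.symm := e.symm.continuous
  refine ⟨e.symm, arcTime b (2 * Real.pi), integral_abs_sin_rpow_pos hb Real.two_pi_pos,
    e.symm.strictMono, hcont, e.symm.surjective, ?_, fun t => ?_, fun k => ?_, fun t ht => ?_⟩
  · rw [e.symm_apply_eq, he, arcTime_zero]
  · rw [e.symm_apply_eq, he, arcTime_add_two_pi hb, ← he (e.symm t), e.apply_symm_apply]
  · rw [e.symm_apply_eq, he, arcTime_nat_mul hb]
  · rw [Real.rpow_neg (abs_nonneg _)]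
    exact HasDerivAt.of_local_left_inverse hcont.continuousAt (hasDerivAt_arcTime hb ht)
      (Real.rpow_pos_of_pos (abs_pos.2 ht) _).ne' (Eventually.of_forall e.apply_symm_apply)

/-- A continuous function with a continuous derivative candidate, valid off a countable set, is
differentiable everywhere. -/
theorem hasDerivAt_of_off_countable {f g : ℝ → ℝ} {s : Set ℝ} (hs : s.Countable)
    (hf : Continuous f) (hg : Continuous g) (h : ∀ t ∉ s, HasDerivAt f (g t) t) (t : ℝ) :
    HasDerivAt f (g t) t := by
  -- The fundamental theorem of calculus tolerates a countable exceptional set; a primitive of the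
  -- continuous `g` is then differentiable everywhere.
  have key : ∀ x, f x = f 0 + ∫ y in (0 : ℝ)..x, g y := fun x => by
    rw [MeasureTheory.integral_eq_of_hasDerivAt_off_countable f g hs hf.continuousOn
      (fun y hy => h y hy.2) (hg.intervalIntegrable _ _)]
    ring
  rw [funext key]
  exact (intervalIntegral.integral_hasDerivAt_right (hg.intervalIntegrable _ _)
    hg.stronglyMeasurable.stronglyMeasurableAtFilter hg.continuousAt).const_add _

theorem periodic_deriv {f : ℝ → ℝ} {P : ℝ} (h : Function.Periodic f P) :
    Function.Periodic (deriv f) P := fun t => by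
  rw [← deriv_comp_add_const f P t, show (fun x => f (x + P)) = f from funext h]

/-! ### The generalized sine -/

/-- A periodic solution of `w'' = -w |w| ^ (q - 1)` together with its exact set of periods. -/
theorem exists_generalizedSine {q : ℝ} (hq : 0 < q) :
    ∃ S C : ℝ → ℝ, ∃ T : ℝ, 0 < T ∧ (∀ t, HasDerivAt S (C t) t) ∧
      (∀ t, HasDerivAt C (-signedPow q (S t)) t) ∧ S 0 = 0 ∧ 0 < C 0 ∧
      Function.Periodic S T ∧ IsSignChanging S ∧
      ∀ P, 0 < P → Function.Periodic S P → ∃ k : ℕ, 1 ≤ k ∧ P = k * T := by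
  -- With `p (q + 1) = 2`, the ansatz `S = signedPow p (sin ψ)`, `S' = p cos ψ` turns conservation
  -- of energy into `sin² + cos² = 1`. It requires `ψ' = |sin ψ| ^ (1 - p)`, hence the exponent `b =
  -- p - 1 > -1` for the phase.
  set p : ℝ := 2 / (q + 1) with hp
  have hq1 : 0 < q + 1 := by linarith
  have hp0 : 0 < p := by positivity
  have hpq : p * q = 2 - p := by rw [hp]; field_simp; ring
  obtain ⟨ψ, T, hT, hmono, hcont, hsurj, hψ0, hψT, hψk, hψd⟩ :=
    exists_phase (b := p - 1) (by linarith)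
  have hcount : {t | Real.sin (ψ t) = 0}.Countable :=
    countable_sin_eq_zero.preimage_of_injOn hmono.injective.injOn
  have hS : ∀ t, HasDerivAt (fun t => signedPow p (Real.sin (ψ t))) (p * Real.cos (ψ t)) t := by
    refine hasDerivAt_of_off_countable hcount
      ((continuous_signedPow hp0).comp (Real.continuous_sin.comp hcont)) (by fun_prop) ?_
    intro t ht
    refine ((hasDerivAt_signedPow p ht).comp t
      ((Real.hasDerivAt_sin (ψ t)).comp t (hψd t ht))).congr_deriv ?_
    have := Real.rpow_pos_of_pos (abs_pos.2 ht) (p - 1)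
    rw [Real.rpow_neg (abs_nonneg _)]
    field_simp
  have hF : ∀ x, x * |x| ^ (-(p - 1)) = signedPow q (signedPow p x) := fun x => by
    rcases eq_or_ne x 0 with rfl | hx
    · simp
    · have hx' := abs_pos.2 hx
      rw [signedPow, abs_signedPow hp0, signedPow, ← Real.rpow_mul hx'.le, mul_assoc,
        ← Real.rpow_add hx']
      congr 2
      linear_combination -hpq
  have hC : ∀ t, HasDerivAt (fun t => Real.cos (ψ t))
      (-signedPow q (signedPow p (Real.sin (ψ t)))) t := by
    refine hasDerivAt_of_off_countable hcount (by fun_prop)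
      ((continuous_signedPow hq).comp ((continuous_signedPow hp0).comp
        (Real.continuous_sin.comp hcont))).neg ?_
    intro t ht
    refine ((Real.hasDerivAt_cos (ψ t)).comp t (hψd t ht)).congr_deriv ?_
    rw [← hF]
    ring
  -- So far `S'' = -p * signedPow q S`; running time at speed `m` with `p m² = 1` removes the factor
  -- `p`.
  set m : ℝ := Real.sqrt ((q + 1) / 2) with hm
  have hm0 : 0 < m := Real.sqrt_pos.2 (by positivity)
  have hm2 : m * m = (q + 1) / 2 := Real.mul_self_sqrt (by positivity)
  have hmm : ∀ t : ℝ, HasDerivAt (fun t => m * t) m t := fun t => by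
    simpa using (hasDerivAt_id t).const_mul m
  have hval : ∀ t, m * (t / m) = t := fun t => by field_simp
  have hder : ∀ t, HasDerivAt (fun t => signedPow p (Real.sin (ψ (m * t))))
      (p * Real.cos (ψ (m * t)) * m) t := fun t => (hS (m * t)).comp t (hmm t)
  refine ⟨fun t => signedPow p (Real.sin (ψ (m * t))), fun t => p * Real.cos (ψ (m * t)) * m,
    T / m, by positivity, hder, fun t => ?_, by simp [hψ0], ?_, fun t => ?_, ⟨?_, ?_⟩, ?_⟩
  · refine ((((hC (m * t)).comp t (hmm t)).const_mul p).mul_const m).congr_deriv ?_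
    have : p * (m * m) = 1 := by rw [hm2, hp]; field_simp
    linear_combination (-signedPow q (signedPow p (Real.sin (ψ (m * t))))) * this
  · simp only [mul_zero, hψ0, Real.cos_zero]
    positivity
  · simp only [mul_add, hval, hψT, Real.sin_add_two_pi]
  · obtain ⟨t, ht⟩ := hsurj (Real.pi / 2)
    refine ⟨t / m, ?_⟩
    simp only [hval, ht, Real.sin_pi_div_two]
    exact signedPow_pos one_pos
  · obtain ⟨t, ht⟩ := hsurj (-(Real.pi / 2))
    refine ⟨t / m, ?_⟩
    simp only [hval, ht, Real.sin_neg, Real.sin_pi_div_two, signedPow_neg, neg_lt_zero]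
    exact signedPow_pos one_pos
  · intro P hP hper
    have h1 := hper 0
    simp only [zero_add, mul_zero, hψ0, Real.sin_zero, signedPow_zero, signedPow_eq_zero] at h1
    -- A period of `S` is one of `S'`, and `S'` is proportional to `cos ψ`. Hence `ψ (m P)` is a
    -- positive multiple of `2π`, and injectivity of `ψ` makes `m P` a multiple of `T`.
    have h2 : Real.cos (ψ (m * P)) = 1 := by
      have e1 := periodic_deriv hper 0
      rw [zero_add] at e1
      rw [(hder P).deriv, (hder 0).deriv] at e1
      simp only [mul_zero, hψ0, Real.cos_zero] at e1
      have := mul_left_cancel₀ hp0.ne' (mul_right_cancel₀ hm0.ne' e1)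
      exact this
    obtain ⟨n, hn⟩ := (Real.cos_eq_one_iff _).1 h2
    have hpos : 0 < ψ (m * P) := by
      rw [← hψ0]; exact hmono (by positivity)
    have hn0 : 0 < n := by
      rw [← hn] at hpos
      exact_mod_cast pos_of_mul_pos_left hpos Real.two_pi_pos.le
    lift n to ℕ using hn0.le
    refine ⟨n, by omega, ?_⟩
    have h3 : m * P = n * T := by
      apply hmono.injective
      rw [hψk, ← hn]
      norm_cast
    field_simp
    linarith

/-! ### Solutions of the angular equation -/

theorem isODESolution_iff {ε q : ℝ} (hq : 0 < q) {w : ℝ → ℝ} :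
    IsODESolution 0 ε q w ↔ (∀ t, HasDerivAt w (deriv w t) t) ∧
      ∀ t, HasDerivAt (deriv w) (ε * signedPow q (w t)) t := by
  constructor
  · rintro ⟨h1, h2⟩
    have h3 : ContDiff ℝ 1 (deriv w) := by
      have : ContDiff ℝ (1 + 1) w := by simpa [one_add_one_eq_two] using h1
      exact (contDiff_succ_iff_deriv.1 this).2.2
    refine ⟨fun t => (h1.differentiable (by norm_num) t).hasDerivAt, fun t => ?_⟩
    have := (h3.differentiable (by norm_num) t).hasDerivAt
    rwa [show deriv (deriv w) t = ε * signedPow q (w t) by simpa [signedPow] using h2 t] at this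
  · rintro ⟨h1, h2⟩
    have hw : Continuous w := continuous_iff_continuousAt.2 fun t => (h1 t).continuousAt
    refine ⟨?_, fun t => by simp [(h2 t).deriv, signedPow]⟩
    have h3 : ContDiff ℝ 1 (deriv w) := by
      refine contDiff_one_iff_deriv.2 ⟨fun t => (h2 t).differentiableAt, ?_⟩
      rw [funext fun t => (h2 t).deriv]
      exact continuous_const.mul ((continuous_signedPow hq).comp hw)
    have : ContDiff ℝ (1 + 1) w :=
      contDiff_succ_iff_deriv.2 ⟨fun t => (h1 t).differentiableAt, by simp, h3⟩
    simpa [one_add_one_eq_two] using this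

theorem isODESolution_of_hasDerivAt {ε q : ℝ} (hq : 0 < q) {S C : ℝ → ℝ}
    (hS : ∀ t, HasDerivAt S (C t) t) (hC : ∀ t, HasDerivAt C (ε * signedPow q (S t)) t) :
    IsODESolution 0 ε q S := by
  have : deriv S = C := funext fun t => (hS t).deriv
  rw [isODESolution_iff hq, this]
  exact ⟨hS, hC⟩

theorem energy_eq {q : ℝ} (hq : 0 < q) {w : ℝ → ℝ} (hw : IsODESolution 0 (-1) q w) (s t : ℝ) :
    deriv w s ^ 2 + 2 / (q + 1) * |w s| ^ (q + 1) =
      deriv w t ^ 2 + 2 / (q + 1) * |w t| ^ (q + 1) := by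
  obtain ⟨h1, h2⟩ := (isODESolution_iff hq).1 hw
  have hd : ∀ t, HasDerivAt (fun t => deriv w t ^ 2 + 2 / (q + 1) * |w t| ^ (q + 1)) 0 t := by
    intro t
    refine (((h2 t).pow 2).add (((hasDerivAt_abs_rpow_add_one hq (w t)).comp t
      (h1 t)).const_mul (2 / (q + 1)))).congr_deriv ?_
    have : q + 1 ≠ 0 := by linarith
    simp only [Nat.cast_ofNat, Nat.add_one_sub_one, pow_one]
    field_simp
    ring
  exact is_const_of_deriv_eq_zero (fun t => (hd t).differentiableAt) (fun t => (hd t).deriv) s t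

/-- Away from `v = 0` the first-order system for `(v, v')` has a `C¹` right-hand side, so
Picard–Lindelöf applies for every `q`. -/
theorem eventuallyEq_of_ne_zero {q : ℝ} (hq : 0 < q) {v w : ℝ → ℝ}
    (hv : IsODESolution 0 (-1) q v) (hw : IsODESolution 0 (-1) q w) {t : ℝ}
    (h0 : v t = w t) (h1 : deriv v t = deriv w t) (hne : v t ≠ 0) : v =ᶠ[𝓝 t] w := by
  obtain ⟨hv1, hv2⟩ := (isODESolution_iff hq).1 hv
  obtain ⟨hw1, hw2⟩ := (isODESolution_iff hq).1 hw
  have hG : ContDiffAt ℝ 1 (fun z : ℝ × ℝ => (z.2, -1 * signedPow q z.1)) (v t, deriv v t) := by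
    refine contDiffAt_snd.prodMk (contDiffAt_const.mul ?_)
    exact ContDiffAt.comp (v t, deriv v t) (contDiffAt_signedPow q hne) contDiffAt_fst
  obtain ⟨K, s, hs, hK⟩ := hG.exists_lipschitzOnWith
  have key : ∀ f : ℝ → ℝ, (∀ t, HasDerivAt f (deriv f t) t) →
      (∀ t, HasDerivAt (deriv f) (-1 * signedPow q (f t)) t) → f t = v t →
      deriv f t = deriv v t → ∀ᶠ x in 𝓝 t, HasDerivAt (fun x => (f x, deriv f x))
        ((fun z : ℝ × ℝ => (z.2, -1 * signedPow q z.1)) (f x, deriv f x)) x ∧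
        (f x, deriv f x) ∈ s := by
    intro f hf1 hf2 e0 e1
    have hc : ContinuousAt (fun x => (f x, deriv f x)) t :=
      (hf1 t).continuousAt.prodMk (hf2 t).continuousAt
    have hs' : s ∈ 𝓝 (f t, deriv f t) := by rwa [e0, e1]
    filter_upwards [hc.eventually_mem hs'] with x hx
    exact ⟨(hf1 x).prodMk (hf2 x), hx⟩
  have := ODE_solution_unique_of_eventually (v := fun _ => fun z : ℝ × ℝ =>
    (z.2, -1 * signedPow q z.1)) (s := fun _ => s) (Eventually.of_forall fun _ => hK)
    (key v hv1 hv2 rfl rfl) (key w hw1 hw2 h0.symm h1.symm) (Prod.ext h0 h1)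
  exact this.mono fun x hx => congrArg Prod.fst hx

/-- For `q < 1` the system is not Lipschitz at a zero of `v`. Energy conservation and `v' > 0`
reduce it to the scalar equation `v' = G(v)`, and `G` is `C¹` near `0` because `q + 1 > 1` and the
radicand is positive there. -/
theorem eventuallyEq_of_deriv_pos {q : ℝ} (hq : 0 < q) {v w : ℝ → ℝ}
    (hv : IsODESolution 0 (-1) q v) (hw : IsODESolution 0 (-1) q w) {t : ℝ}
    (h0 : v t = 0) (h0' : w t = 0) (h1 : deriv v t = deriv w t) (hpos : 0 < deriv v t) :
    v =ᶠ[𝓝 t] w := by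
  set G : ℝ → ℝ := fun x => Real.sqrt (deriv v t ^ 2 - 2 / (q + 1) * |x| ^ (q + 1)) with hGdef
  have hG : ContDiffAt ℝ 1 G 0 := by
    refine ContDiffAt.sqrt ?_ ?_
    · have := (contDiff_norm_rpow (E := ℝ) (p := q + 1) (by linarith)).contDiffAt (x := 0)
      exact contDiffAt_const.sub (contDiffAt_const.mul this)
    · have : q + 1 ≠ 0 := by linarith
      simp [Real.zero_rpow this, hpos.ne']
  obtain ⟨K, s, hs, hK⟩ := hG.exists_lipschitzOnWith
  have key : ∀ f : ℝ → ℝ, IsODESolution 0 (-1) q f → f t = 0 → deriv f t = deriv v t →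
      ∀ᶠ x in 𝓝 t, HasDerivAt f (G (f x)) x ∧ f x ∈ s := by
    intro f hf e0 e1
    obtain ⟨hf1, hf2⟩ := (isODESolution_iff hq).1 hf
    have hs' : s ∈ 𝓝 (f t) := by rwa [e0]
    filter_upwards [(hf1 t).continuousAt.eventually_mem hs',
      (hf2 t).continuousAt.eventually_const_lt (by rwa [e1])] with x hx hx'
    refine ⟨?_, hx⟩
    have hE := energy_eq hq hf x t
    rw [e0, e1, abs_zero, Real.zero_rpow (by linarith), mul_zero, add_zero] at hE
    have : G (f x) = deriv f x := by
      rw [hGdef]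
      beta_reduce
      rw [← hE, add_sub_cancel_right, Real.sqrt_sq hx'.le]
    rw [this]
    exact hf1 x
  exact ODE_solution_unique_of_eventually (v := fun _ => G) (s := fun _ => s)
    (Eventually.of_forall fun _ => hK) (key v hv h0 rfl) (key w hw h0' h1.symm)
    (h0.trans h0'.symm)

theorem IsODESolution.smul_sign {q s : ℝ} (hq : 0 < q) (hs : s = 1 ∨ s = -1) {w : ℝ → ℝ}
    (hw : IsODESolution 0 (-1) q w) : IsODESolution 0 (-1) q (fun t => s * w t) := by
  obtain ⟨h1, h2⟩ := (isODESolution_iff hq).1 hw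
  refine isODESolution_of_hasDerivAt hq (fun t => (h1 t).const_mul s) fun t => ?_
  refine ((h2 t).const_mul s).congr_deriv ?_
  rcases hs with rfl | rfl
  · simp
  · simp [signedPow_neg]

theorem IsODESolution.comp_sub {ε q : ℝ} (hq : 0 < q) {w : ℝ → ℝ}
    (hw : IsODESolution 0 ε q w) (φ : ℝ) : IsODESolution 0 ε q (fun t => w (t - φ)) := by
  obtain ⟨h1, h2⟩ := (isODESolution_iff hq).1 hw
  exact isODESolution_of_hasDerivAt hq (fun t => (h1 (t - φ)).comp_sub_const t φ)
    fun t => (h2 (t - φ)).comp_sub_const t φ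

/-- Two solutions with the same Cauchy data of nonzero slope at a common zero agree. -/
theorem solution_unique {q : ℝ} (hq : 0 < q) {v w : ℝ → ℝ}
    (hv : IsODESolution 0 (-1) q v) (hw : IsODESolution 0 (-1) q w) {t₀ : ℝ}
    (h0 : v t₀ = 0) (h0' : w t₀ = 0) (h1 : deriv v t₀ = deriv w t₀) (hne : deriv v t₀ ≠ 0) :
    v = w := by
  obtain ⟨hv1, hv2⟩ := (isODESolution_iff hq).1 hv
  obtain ⟨hw1, hw2⟩ := (isODESolution_iff hq).1 hw
  have hcont : ∀ {f g : ℝ → ℝ}, (∀ t, HasDerivAt f (g t) t) → Continuous f := fun h =>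
    continuous_iff_continuousAt.2 fun t => (h t).continuousAt
  -- The set where the Cauchy data agree is nonempty and closed; local uniqueness makes it open,
  -- hence all of `ℝ`.
  set A : Set ℝ := {t | v t = w t ∧ deriv v t = deriv w t} with hA
  have hclosed : IsClosed A :=
    (isClosed_eq (hcont hv1) (hcont hw1)).inter (isClosed_eq (hcont hv2) (hcont hw2))
  have hopen : IsOpen A := by
    refine isOpen_iff_mem_nhds.2 fun t ht => ?_
    have hloc : v =ᶠ[𝓝 t] w := by
      by_cases hvt : v t = 0
      · have hwt : w t = 0 := ht.1 ▸ hvt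
        -- The energy is positive, since it is so at `t₀`; thus every zero of `v` is nondegenerate.
        have hd : deriv v t ≠ 0 := by
          intro h
          have := energy_eq hq hv t₀ t
          rw [h0, hvt, h, abs_zero, Real.zero_rpow (by linarith)] at this
          simp at this
          exact hne this
        rcases lt_or_gt_of_ne hd with hneg | hpos
        · have := eventuallyEq_of_deriv_pos hq (hv.smul_sign hq (Or.inr rfl))
            (hw.smul_sign hq (Or.inr rfl)) (t := t) (by simp [hvt]) (by simp [hwt])
            (by simp [ht.2]) (by simpa [deriv_const_mul_field] using hneg)
          filter_upwards [this] with x hx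
          linarith
        · exact eventuallyEq_of_deriv_pos hq hv hw hvt hwt ht.2 hpos
      · exact eventuallyEq_of_ne_zero hq hv hw ht.1 ht.2 hvt
    filter_upwards [hloc, hloc.deriv] with x hx hx'
    exact ⟨hx, hx'⟩
  have huniv : A = univ :=
    IsClopen.eq_univ ⟨hclosed, hopen⟩ ⟨t₀, h0.trans h0'.symm, h1⟩
  funext t
  exact (huniv ▸ mem_univ t : t ∈ A).1

/-- A solution with a degenerate zero vanishes. -/
theorem eq_zero_of_degenerate {q : ℝ} (hq : 0 < q) {v : ℝ → ℝ} (hv : IsODESolution 0 (-1) q v)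
    {t₀ : ℝ} (h0 : v t₀ = 0) (h1 : deriv v t₀ = 0) (t : ℝ) : v t = 0 := by
  have h := energy_eq hq hv t t₀
  rw [h0, h1, abs_zero, Real.zero_rpow (by linarith)] at h
  have h2 : 0 ≤ 2 / (q + 1) * |v t| ^ (q + 1) := by positivity
  have h3 : 2 / (q + 1) * |v t| ^ (q + 1) = 0 := by nlinarith [sq_nonneg (deriv v t)]
  by_contra hne
  have : 0 < |v t| ^ (q + 1) := Real.rpow_pos_of_pos (abs_pos.2 hne) _
  have : 0 < 2 / (q + 1) * |v t| ^ (q + 1) := by positivity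
  linarith

/-! ### Scaling and classification of the modes -/

/-- The dilations preserving the angular equation. -/
def rescale (q : ℝ) (S : ℝ → ℝ) (c t : ℝ) : ℝ := c ^ (2 / (q - 1)) * S (c * t)

theorem hasDerivAt_rescale {q c : ℝ} {S C : ℝ → ℝ} (hS : ∀ t, HasDerivAt S (C t) t) (t : ℝ) :
    HasDerivAt (rescale q S c) (c ^ (2 / (q - 1)) * (C (c * t) * c)) t := by
  have h : HasDerivAt (fun t => c * t) c t := by simpa using (hasDerivAt_id t).const_mul c
  exact ((hS (c * t)).comp t h).const_mul _

/-- The exponent `a = 2 / (q - 1)` balances the two sides: two derivatives bring out `c ^ (a + 2)`,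
the nonlinearity `c ^ (a q)`, and `a q = a + 2`. -/
theorem isODESolution_rescale {q c : ℝ} (hq : 0 < q) (hq1 : q ≠ 1) (hc : 0 < c) {S C : ℝ → ℝ}
    (hS : ∀ t, HasDerivAt S (C t) t) (hC : ∀ t, HasDerivAt C (-signedPow q (S t)) t) :
    IsODESolution 0 (-1) q (rescale q S c) := by
  refine isODESolution_of_hasDerivAt hq (hasDerivAt_rescale hS) fun t => ?_
  have h : HasDerivAt (fun t => c * t) c t := by simpa using (hasDerivAt_id t).const_mul c
  refine ((((hC (c * t)).comp t h).mul_const c).const_mul _).congr_deriv ?_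
  have hc' := Real.rpow_pos_of_pos hc (2 / (q - 1))
  have e : (c ^ (2 / (q - 1))) ^ q = c ^ (2 / (q - 1)) * c * c := by
    rw [← Real.rpow_mul hc.le, ← Real.rpow_add_one hc.ne', ← Real.rpow_add_one hc.ne']
    congr 1
    have : q - 1 ≠ 0 := sub_ne_zero.2 hq1
    field_simp
    ring
  rw [rescale, signedPow_mul, signedPow_of_pos hc', e]
  ring

theorem periodic_rescale_iff {q c : ℝ} (hc : 0 < c) {S : ℝ → ℝ} {P : ℝ} :
    Function.Periodic (rescale q S c) P ↔ Function.Periodic S (c * P) := by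
  have hc' := (Real.rpow_pos_of_pos hc (2 / (q - 1))).ne'
  constructor
  · intro h t
    have := mul_left_cancel₀ hc' (h (t / c))
    rwa [mul_add, mul_div_cancel₀ _ hc.ne'] at this
  · intro h t
    simp only [rescale, mul_add]
    rw [h]

theorem periodic_sign_mul_comp_sub {s φ P : ℝ} (hs : s = 1 ∨ s = -1) {f g : ℝ → ℝ}
    (h : ∀ θ, f θ = s * g (θ - φ)) : Function.Periodic f P ↔ Function.Periodic g P := by
  have hs0 : s ≠ 0 := by rcases hs with rfl | rfl <;> norm_num
  constructor
  · intro hf t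
    have := hf (t + φ)
    rw [h, h] at this
    have := mul_left_cancel₀ hs0 this
    rw [add_sub_cancel_right] at this
    rw [← this]
    congr 1
    ring
  · intro hg t
    rw [h, h, ← hg (t - φ)]
    congr 2
    ring

/-- Up to sign and translation, every nontrivial solution with a zero is a dilation of `S`. -/
theorem exists_eq_rescale {q : ℝ} (hq : 0 < q) (hq1 : q ≠ 1) {S C : ℝ → ℝ}
    (hS : ∀ t, HasDerivAt S (C t) t) (hC : ∀ t, HasDerivAt C (-signedPow q (S t)) t)
    (hS0 : S 0 = 0) (hC0 : 0 < C 0) {v : ℝ → ℝ} (hv : IsODESolution 0 (-1) q v) {φ : ℝ}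
    (hφ : v φ = 0) (hv0 : ∃ t, v t ≠ 0) :
    ∃ c s : ℝ, 0 < c ∧ (s = 1 ∨ s = -1) ∧ ∀ t, v t = s * rescale q S c (t - φ) := by
  have hd : deriv v φ ≠ 0 := fun h => by
    obtain ⟨t, ht⟩ := hv0
    exact ht (eq_zero_of_degenerate hq hv hφ h t)
  obtain ⟨s, hs, hsd⟩ : ∃ s : ℝ, (s = 1 ∨ s = -1) ∧ deriv v φ = s * |deriv v φ| := by
    rcases lt_or_gt_of_ne hd with h | h
    · exact ⟨-1, Or.inr rfl, by rw [abs_of_neg h]; ring⟩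
    · exact ⟨1, Or.inl rfl, by rw [abs_of_pos h]; ring⟩
  have ha : 0 < |deriv v φ| / C 0 := div_pos (abs_pos.2 hd) hC0
  -- The dilation by `c` has slope `c ^ ((q + 1) / (q - 1)) * C 0` at `0`; this `c` makes it equal
  -- to `|v' φ|`.
  set c : ℝ := (|deriv v φ| / C 0) ^ ((q - 1) / (q + 1)) with hcdef
  have hc : 0 < c := Real.rpow_pos_of_pos ha _
  have hcpow : c ^ (2 / (q - 1)) * c = |deriv v φ| / C 0 := by
    rw [← Real.rpow_add_one hc.ne', hcdef, ← Real.rpow_mul ha.le]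
    have h1 : q - 1 ≠ 0 := sub_ne_zero.2 hq1
    have h2 : q + 1 ≠ 0 := by linarith
    rw [show (q - 1) / (q + 1) * (2 / (q - 1) + 1) = 1 by field_simp; ring, Real.rpow_one]
  refine ⟨c, s, hc, hs, fun t => ?_⟩
  have hw : IsODESolution 0 (-1) q (fun t => s * rescale q S c (t - φ)) :=
    ((isODESolution_rescale hq hq1 hc hS hC).comp_sub hq φ).smul_sign hq hs
  refine congrFun (solution_unique hq hv hw hφ (by simp [rescale, hS0]) ?_ hd) t
  rw [(((hasDerivAt_rescale hS (φ - φ)).comp_sub_const φ φ).const_mul s).deriv]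
  rw [sub_self, mul_zero, hsd]
  congr 1
  field_simp at hcpow
  linarith

theorem IsSignChanging.exists_eq_zero {v : ℝ → ℝ} (h : IsSignChanging v) (hv : Continuous v) :
    ∃ φ, v φ = 0 := by
  obtain ⟨⟨a, ha⟩, b, hb⟩ := h
  exact mem_range_of_exists_le_of_exists_ge hv ⟨b, hb.le⟩ ⟨a, ha.le⟩

/-- The family of angular modes. -/
theorem exists_angularModes {q : ℝ} (hq : 0 < q) (hq1 : q ≠ 1) :
    ∃ w : ℕ → ℝ → ℝ, (∀ k, 1 ≤ k → IsAngularMode q k (w k) ∧ w k 0 = 0) ∧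
      (∀ k, 1 ≤ k → ∀ v, IsAngularMode q k v → ∀ φ, v φ = 0 →
        ∃ s : ℝ, (s = 1 ∨ s = -1) ∧ ∀ θ, v θ = s * w k (θ - φ)) ∧
      ∀ v, IsODESolution 0 (-1) q v → IsSignChanging v → Function.Periodic v (2 * Real.pi) →
        ∃ k, 1 ≤ k ∧ ∃ s φ : ℝ, (s = 1 ∨ s = -1) ∧ ∀ θ, v θ = s * w k (θ - φ) := by
  obtain ⟨S, C, T, hT, hS, hC, hS0, hC0, hST, hsign, hper⟩ := exists_generalizedSine hq
  have hπ := Real.pi_pos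
  -- Dilating by `c` divides the least period `T` by `c`; requiring `T / c = 2π / k` gives this
  -- factor.
  refine ⟨fun k => rescale q S (k * T / (2 * Real.pi)), fun k hk => ?_, fun k hk v hv φ hφ => ?_,
    fun v hv hvs hvp => ?_⟩
  · have hk0 : (0 : ℝ) < k := by exact_mod_cast hk
    have hc : 0 < k * T / (2 * Real.pi) := by positivity
    refine ⟨⟨isODESolution_rescale hq hq1 hc hS hC, ?_, ⟨by positivity, ?_⟩, ?_⟩,
      by simp [rescale, hS0]⟩
    · have hc' := Real.rpow_pos_of_pos hc (2 / (q - 1))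
      obtain ⟨⟨a, ha⟩, b, hb⟩ := hsign
      refine ⟨⟨a / (k * T / (2 * Real.pi)), ?_⟩, b / (k * T / (2 * Real.pi)), ?_⟩
      · simp only [rescale, mul_div_cancel₀ _ hc.ne']
        exact mul_pos hc' ha
      · simp only [rescale, mul_div_cancel₀ _ hc.ne']
        exact mul_neg_of_pos_of_neg hc' hb
    · rw [periodic_rescale_iff hc]
      convert hST using 1
      field_simp
    · rintro P ⟨hP, hP'⟩
      rw [periodic_rescale_iff hc] at hP'
      obtain ⟨j, hj, hjP⟩ := hper _ (by positivity) hP'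
      have hj1 : (1 : ℝ) ≤ j := by exact_mod_cast hj
      rw [div_le_iff₀ hk0]
      field_simp at hjP
      nlinarith
  · have hk0 : (0 : ℝ) < k := by exact_mod_cast hk
    obtain ⟨hv1, hv2, ⟨-, hv3⟩, hv4⟩ := hv
    obtain ⟨c, s, hc, hs, hcs⟩ := exists_eq_rescale hq hq1 hS hC hS0 hC0 hv1 hφ
      (hv2.1.imp fun _ h => h.ne')
    refine ⟨s, hs, ?_⟩
    rw [periodic_sign_mul_comp_sub hs hcs, periodic_rescale_iff hc] at hv3
    obtain ⟨j, hj, hjP⟩ := hper _ (by positivity) hv3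
    -- The period `2π / k` equals `j T / c` with `j ≥ 1`, while `T / c` is itself a period;
    -- minimality forces `j = 1`.
    have hle := hv4 (a := T / c) ⟨by positivity, by
      rw [periodic_sign_mul_comp_sub hs hcs, periodic_rescale_iff hc, mul_div_cancel₀ _ hc.ne']
      exact hST⟩
    have hle' : c * (2 * Real.pi / k) ≤ T := by
      rw [le_div_iff₀ hc] at hle
      linarith
    rw [hjP] at hle'
    have hj1 : (1 : ℝ) ≤ j := by exact_mod_cast hj
    have hj' : (j : ℝ) = 1 := le_antisymm (by nlinarith) hj1
    rw [hj', one_mul] at hjP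
    have : c = k * T / (2 * Real.pi) := by
      rw [← hjP]; field_simp
    rwa [this] at hcs
  · obtain ⟨φ, hφ⟩ := hvs.exists_eq_zero hv.1.continuous
    obtain ⟨c, s, hc, hs, hcs⟩ := exists_eq_rescale hq hq1 hS hC hS0 hC0 hv hφ
      (hvs.1.imp fun _ h => h.ne')
    rw [periodic_sign_mul_comp_sub hs hcs, periodic_rescale_iff hc] at hvp
    obtain ⟨k, hk, hkP⟩ := hper _ (by positivity) hvp
    have : c = k * T / (2 * Real.pi) := by
      rw [← hkP]; field_simp
    refine ⟨k, hk, s, φ, hs, ?_⟩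
    rwa [this] at hcs

/-! ### Periodic solutions -/

/-- A nonnegative derivative of a periodic function vanishes. -/
theorem deriv_eq_zero_of_periodic_of_nonneg {f g : ℝ → ℝ} {P : ℝ} (hP : 0 < P)
    (hf : ∀ t, HasDerivAt f (g t) t) (hper : Function.Periodic f P) (hg : ∀ t, 0 ≤ g t) (t : ℝ) :
    g t = 0 := by
  have hmono : Monotone f := monotone_of_hasDerivAt_nonneg hf hg
  have hconst : ∀ x y, x ≤ y → f x = f y := fun x y hxy => by
    refine le_antisymm (hmono hxy) ?_
    -- A monotone periodic function is constant: `y` lies below a translate of `x` by whole periods.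
    obtain ⟨n, hn⟩ := exists_nat_ge ((y - x) / P)
    have h1 : y ≤ x + n * P := by
      rw [div_le_iff₀ hP] at hn
      linarith
    calc f y ≤ f (x + n * P) := hmono h1
      _ = f x := hper.nat_mul n x
  have hc : f = fun _ => f t := funext fun x => by
    rcases le_total x t with h | h
    · exact hconst x t h
    · exact (hconst t x h).symm
  have := hf t
  rw [hc] at this
  exact this.unique (hasDerivAt_const t _)

/-- The periodic function `w w'` has derivative `w'² + |w| ^ (q + 1) ≥ 0`, which must therefore
vanish; so `w' = 0`. -/
theorem const_of_periodic_pos {q P : ℝ} (hq : 0 < q) (hP : 0 < P) {w : ℝ → ℝ}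
    (hw : IsODESolution 0 1 q w) (hper : Function.Periodic w P) (x y : ℝ) : w x = w y := by
  obtain ⟨h1, h2⟩ := (isODESolution_iff hq).1 hw
  have hnn : ∀ t, 0 ≤ w t * signedPow q (w t) := fun t => mul_signedPow_nonneg q (w t)
  have hz := deriv_eq_zero_of_periodic_of_nonneg (f := fun t => w t * deriv w t)
    (g := fun t => deriv w t * deriv w t + w t * (1 * signedPow q (w t))) hP
    (fun t => (h1 t).mul (h2 t)) (fun t => by simp only [hper t, periodic_deriv hper t])
    (fun t => by nlinarith [hnn t, mul_self_nonneg (deriv w t)])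
  refine is_const_of_deriv_eq_zero (fun t => (h1 t).differentiableAt) (fun t => ?_) x y
  have := hz t
  simp only [one_mul] at this
  exact mul_self_eq_zero.1 (by linarith [hnn t, mul_self_nonneg (deriv w t)])

/-- If `w ≤ 0` everywhere then `w'' ≥ 0`; since `w'` is periodic, `w'' = 0`, and the equation gives
`w = 0`. The same argument applies to `-w`. -/
theorem signChanging_of_periodic {q P : ℝ} (hq : 0 < q) (hP : 0 < P) {w : ℝ → ℝ}
    (hw : IsODESolution 0 (-1) q w) (hper : Function.Periodic w P) (hne : ∃ t, w t ≠ 0) :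
    IsSignChanging w := by
  have key : ∀ v, IsODESolution 0 (-1) q v → Function.Periodic v P → (∃ t, v t ≠ 0) →
      ∃ t, 0 < v t := by
    intro v hv hvp ⟨t, ht⟩
    by_contra! hcon
    obtain ⟨h1, h2⟩ := (isODESolution_iff hq).1 hv
    have hz := deriv_eq_zero_of_periodic_of_nonneg hP h2 (periodic_deriv hvp) (fun t => by
      have : 0 ≤ |v t| ^ (q - 1) := by positivity
      rw [signedPow]
      nlinarith [hcon t, mul_nonneg (neg_nonneg.2 (hcon t)) this]) t
    simp only [neg_mul, one_mul, neg_eq_zero, signedPow_eq_zero] at hz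
    exact ht hz
  refine ⟨key w hw hper hne, ?_⟩
  obtain ⟨t, ht⟩ := key (fun t => -1 * w t) (hw.smul_sign hq (Or.inr rfl))
    (fun t => by simp only [hper t]) (hne.imp fun t ht => by simpa using ht)
  exact ⟨t, by linarith⟩

/-! ### The Laplacian in logarithmic polar coordinates -/

theorem deriv_deriv_comp_curve {E : Type*} [NormedAddCommGroup E] [NormedSpace ℝ E] {u : E → ℝ}
    {γ γ' : ℝ → E} {a : E} {t : ℝ} (hu : ContDiffAt ℝ 2 u (γ t))
    (hγ : ∀ s, HasDerivAt γ (γ' s) s) (hγ' : HasDerivAt γ' a t) :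
    deriv (deriv fun s => u (γ s)) t =
      fderiv ℝ (fderiv ℝ u) (γ t) (γ' t) (γ' t) + fderiv ℝ u (γ t) a := by
  have h1 : ∀ᶠ s in 𝓝 t, deriv (fun s => u (γ s)) s = fderiv ℝ u (γ s) (γ' s) := by
    have := (hγ t).continuousAt.eventually (hu.eventually (by simp))
    filter_upwards [this] with s hs
    exact ((hs.differentiableAt (by norm_num)).hasFDerivAt.comp_hasDerivAt s (hγ s)).deriv
  rw [EventuallyEq.deriv_eq h1]
  have h2 : DifferentiableAt ℝ (fderiv ℝ u) (γ t) :=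
    (hu.fderiv_right (m := 1) (by norm_num)).differentiableAt (by norm_num)
  exact ((h2.hasFDerivAt.comp_hasDerivAt t (hγ t)).clm_apply hγ').deriv

/-- The standard basis vectors of the plane. -/
abbrev planeBasis (i : Fin 2) : Plane := EuclideanSpace.basisFun (Fin 2) ℝ i

theorem polar_eq (r θ : ℝ) :
    polar r θ = (r * Real.cos θ) • planeBasis 0 + (r * Real.sin θ) • planeBasis 1 := by
  ext i
  fin_cases i <;> simp [polar, planeBasis]

theorem hasDerivAt_polar_exp (θ t : ℝ) :
    HasDerivAt (fun t => polar (Real.exp t) θ) (polar (Real.exp t) θ) t := by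
  simp only [polar_eq]
  exact (((Real.hasDerivAt_exp t).mul_const _).smul_const _).add
    (((Real.hasDerivAt_exp t).mul_const _).smul_const _)

theorem hasDerivAt_polar_angle (r θ : ℝ) :
    HasDerivAt (fun θ => polar r θ) (polar r (θ + Real.pi / 2)) θ := by
  simp only [polar_eq, Real.cos_add_pi_div_two, Real.sin_add_pi_div_two]
  exact (((Real.hasDerivAt_cos θ).const_mul r).smul_const _).add
    (((Real.hasDerivAt_sin θ).const_mul r).smul_const _)

theorem laplacian_eq_plane (u : Plane → ℝ) (x : Plane) :
    Laplacian.laplacian u x = fderiv ℝ (fderiv ℝ u) x (planeBasis 0) (planeBasis 0) +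
      fderiv ℝ (fderiv ℝ u) x (planeBasis 1) (planeBasis 1) := by
  rw [InnerProductSpace.laplacian_eq_iteratedFDeriv_orthonormalBasis u
    (EuclideanSpace.basisFun (Fin 2) ℝ)]
  simp [iteratedFDeriv_two_apply]

/-- Differentiate along the ray `t ↦ polar (exp t) θ` and along the circle. Their velocities are
orthogonal of length `exp t`, so the Hessian terms add up to the Laplacian. Their accelerations are
opposite, so the gradient terms cancel. -/
theorem laplacian_logPolar {u : Plane → ℝ} {t θ : ℝ}
    (hu : ContDiffAt ℝ 2 u (polar (Real.exp t) θ)) :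
    deriv (deriv fun t => u (polar (Real.exp t) θ)) t +
      deriv (deriv fun θ => u (polar (Real.exp t) θ)) θ =
      Real.exp t ^ 2 * Laplacian.laplacian u (polar (Real.exp t) θ) := by
  rw [deriv_deriv_comp_curve (γ := fun t => polar (Real.exp t) θ) hu (hasDerivAt_polar_exp θ)
      (hasDerivAt_polar_exp θ t),
    deriv_deriv_comp_curve hu (hasDerivAt_polar_angle _)
      ((hasDerivAt_polar_angle _ (θ + Real.pi / 2)).comp_add_const θ (Real.pi / 2)),
    laplacian_eq_plane]
  set B := fderiv ℝ (fderiv ℝ u) (polar (Real.exp t) θ)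
  set D := fderiv ℝ u (polar (Real.exp t) θ)
  have h := Real.sin_sq_add_cos_sq θ
  simp only [polar_eq, Real.cos_add_pi_div_two, Real.sin_add_pi_div_two, map_add, map_smul,
    add_apply, smul_apply, smul_eq_mul]
  linear_combination Real.exp t ^ 2 *
    (B (planeBasis 0) (planeBasis 0) + B (planeBasis 1) (planeBasis 1)) * h

/-! ### Polar coordinates and regularity -/

theorem norm_polar {r : ℝ} (hr : 0 ≤ r) (θ : ℝ) : ‖polar r θ‖ = r := by
  rw [EuclideanSpace.norm_eq]
  simp only [polar, Fin.sum_univ_two, Real.norm_eq_abs, sq_abs]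
  simp only [Matrix.cons_val_zero, Matrix.cons_val_one, Matrix.cons_val_fin_one]
  rw [show (r * Real.cos θ) ^ 2 + (r * Real.sin θ) ^ 2 =
    r ^ 2 * (Real.sin θ ^ 2 + Real.cos θ ^ 2) by ring, Real.sin_sq_add_cos_sq, mul_one,
    Real.sqrt_sq hr]

/-- The plane vector as a complex number, rotated by `-θ₀`. -/
def rotatedComplex (θ₀ : ℝ) (x : Plane) : ℂ :=
  (x 0 + x 1 * Complex.I) * Complex.exp (-θ₀ * Complex.I)

theorem norm_rotatedComplex (θ₀ : ℝ) (x : Plane) : ‖rotatedComplex θ₀ x‖ = ‖x‖ := by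
  have h : ‖Complex.exp (-θ₀ * Complex.I)‖ = 1 := by
    have := Complex.norm_exp_ofReal_mul_I (-θ₀)
    push_cast at this
    exact this
  rw [rotatedComplex, norm_mul, h, mul_one, EuclideanSpace.norm_eq, Complex.norm_add_mul_I]
  simp [Fin.sum_univ_two]

theorem polar_arg (θ₀ : ℝ) (x : Plane) :
    polar ‖x‖ (θ₀ + Complex.arg (rotatedComplex θ₀ x)) = x := by
  have h1 : (‖x‖ : ℂ) * Complex.exp (((θ₀ + Complex.arg (rotatedComplex θ₀ x) : ℝ) : ℂ) *
      Complex.I) = x 0 + x 1 * Complex.I := by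
    have h2 := Complex.norm_mul_exp_arg_mul_I (rotatedComplex θ₀ x)
    rw [norm_rotatedComplex] at h2
    push_cast
    rw [add_mul, Complex.exp_add, mul_left_comm, h2, rotatedComplex, mul_left_comm,
      ← Complex.exp_add]
    simp
  generalize θ₀ + Complex.arg (rotatedComplex θ₀ x) = α at h1 ⊢
  rw [Complex.exp_mul_I] at h1
  ext i
  fin_cases i
  · have := congrArg Complex.re h1
    simpa [← Complex.ofReal_cos, ← Complex.ofReal_sin, polar] using this
  · have := congrArg Complex.im h1
    simpa [← Complex.ofReal_cos, ← Complex.ofReal_sin, polar] using this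

theorem exists_polar (x : Plane) : ∃ θ, polar ‖x‖ θ = x := ⟨_, polar_arg 0 x⟩

/-- Rotating by `-θ₀` moves the base point to the positive real axis, away from the branch cut of
the logarithm, so `θ₀ + arg` is a smooth local angle. -/
theorem contDiffAt_arg_rotatedComplex {r : ℝ} (hr : 0 < r) (θ₀ : ℝ) :
    ContDiffAt ℝ 2 (fun x => Complex.arg (rotatedComplex θ₀ x)) (polar r θ₀) := by
  have hz : rotatedComplex θ₀ (polar r θ₀) = r := by
    have : (((polar r θ₀) 0 : ℝ) : ℂ) + ((polar r θ₀) 1 : ℝ) * Complex.I =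
        r * Complex.exp (θ₀ * Complex.I) := by
      simp [polar, Complex.exp_mul_I]
      ring
    rw [rotatedComplex, this, mul_assoc, ← Complex.exp_add]
    simp
  have h1 : ContDiff ℝ 2 (rotatedComplex θ₀) := by
    unfold rotatedComplex
    have hc : ∀ i : Fin 2, ContDiff ℝ 2 fun x : Plane => ((x i : ℝ) : ℂ) := fun i =>
      Complex.ofRealCLM.contDiff.comp (contDiff_piLp_apply 2)
    exact ((hc 0).add ((hc 1).mul contDiff_const)).mul contDiff_const
  have h2 : ContDiffAt ℝ 2 Complex.log (rotatedComplex θ₀ (polar r θ₀)) := by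
    refine (Complex.contDiffAt_log ?_).restrict_scalars ℝ
    rw [hz]
    exact Complex.ofReal_mem_slitPlane.2 hr
  have h3 := Complex.imCLM.contDiff.contDiffAt.comp (polar r θ₀)
    (h2.comp (polar r θ₀) h1.contDiffAt)
  exact h3.congr_of_eventuallyEq (Eventually.of_forall fun x => by simp [Complex.log_im])

theorem isOpen_annulus (R₁ : ℝ) (R₂ : EReal) : IsOpen (annulus R₁ R₂) :=
  (isOpen_lt continuous_const continuous_norm).inter
    (isOpen_lt (continuous_coe_real_ereal.comp continuous_norm) continuous_const)

theorem polar_mem_annulus {R₁ : ℝ} {R₂ : EReal} (h0 : 0 ≤ R₁) {r : ℝ} (h1 : R₁ < r)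
    (h2 : (r : EReal) < R₂) (θ : ℝ) : polar r θ ∈ annulus R₁ R₂ := by
  have := norm_polar (h0.trans h1.le) θ
  exact ⟨by rwa [this], by rwa [this]⟩

/-- A product of a smooth radial and a `C²` angular function is `C²`. -/
theorem contDiffOn_of_polar {R₁ : ℝ} {R₂ : EReal} (h0 : 0 ≤ R₁) {M N : ℝ} {w : ℝ → ℝ}
    (hw : ContDiff ℝ 2 w) {u : Plane → ℝ}
    (hu : ∀ r θ : ℝ, R₁ < r → (r : EReal) < R₂ → u (polar r θ) = (M + N * Real.log r) * w θ) :
    ContDiffOn ℝ 2 u (annulus R₁ R₂) := by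
  intro x hx
  refine ContDiffAt.contDiffWithinAt ?_
  obtain ⟨θ₀, hθ₀⟩ := exists_polar x
  have hpos : 0 < ‖x‖ := h0.trans_lt hx.1
  have harg := contDiffAt_arg_rotatedComplex hpos θ₀
  rw [hθ₀] at harg
  have h1 : ContDiffAt ℝ 2 (fun y : Plane => (M + N * Real.log ‖y‖) *
      w (θ₀ + Complex.arg (rotatedComplex θ₀ y))) x := by
    have hx0 : x ≠ 0 := norm_pos_iff.1 hpos
    refine (contDiffAt_const.add (contDiffAt_const.mul
      ((contDiffAt_norm ℝ hx0).log hpos.ne'))).mul ?_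
    exact hw.contDiffAt.comp x (contDiffAt_const.add harg)
  refine h1.congr_of_eventuallyEq ?_
  filter_upwards [(isOpen_annulus R₁ R₂).mem_nhds hx] with y hy
  rw [← hu _ _ hy.1 hy.2, polar_arg]

/-! ### Separation of variables -/

/-- The intermediate value theorem supplies the two values; they make the determinant in
`radial_factor_of_separation` nonzero. -/
theorem exists_abs_ne_of_continuous {w : ℝ → ℝ} (hw : Continuous w) {a b : ℝ}
    (hab : w a < w b) : ∃ x y, w x ≠ 0 ∧ w y ≠ 0 ∧ |w x| ≠ |w y| := by
  have hr : ∀ z, w a ≤ z → z ≤ w b → ∃ x, w x = z := fun z h1 h2 =>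
    mem_range_of_exists_le_of_exists_ge hw ⟨a, h1⟩ ⟨b, h2⟩
  rcases lt_or_ge 0 (w b) with hb | hb
  · have h1 : max (w a) 0 < w b := max_lt hab hb
    have h2 := le_max_left (w a) 0
    have h3 := le_max_right (w a) 0
    obtain ⟨x, hx⟩ := hr ((max (w a) 0 + w b) / 2) (by linarith) (by linarith)
    refine ⟨x, b, ?_, hb.ne', ?_⟩
    · rw [hx]; linarith
    · rw [hx, abs_of_pos (by linarith), abs_of_pos hb]; linarith
  · have ha : w a < 0 := hab.trans_le hb
    obtain ⟨x, hx⟩ := hr ((w a + w b) / 2) (by linarith) (by linarith)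
    refine ⟨a, x, ha.ne, ?_, ?_⟩
    · rw [hx]; linarith
    · rw [hx, abs_of_neg ha, abs_of_neg (by linarith)]
      intro h
      linarith

theorem rpow_injective_of_ne {x y p : ℝ} (hx : 0 < x) (hy : 0 < y) (hp : p ≠ 0)
    (h : x ^ p = y ^ p) : x = y :=
  Real.rpow_left_injOn hp hx.le hy.le h

/-- Combining the equations at two angles eliminates `f₂` and leaves `(|f| / p) ^ (q - 1)` equal to
a constant wherever `f ≠ 0`. As `q ≠ 1`, the continuous function `f / p` takes values in a finite
set `{0, y₀, -y₀}`, and is constant on the connected set `I`. -/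
theorem radial_factor_of_separation {q ε : ℝ} (hq1 : q ≠ 1) (hε : ε ≠ 0) {I : Set ℝ}
    (hI : IsPreconnected I) {p f f₂ w w₂ : ℝ → ℝ} (hp : ∀ t ∈ I, 0 < p t) (hpc : ContinuousOn p I)
    (hf : ContinuousOn f I) (hw : Continuous w)
    (heq : ∀ t ∈ I, ∀ θ, f₂ t * w θ + f t * w₂ θ =
      ε * p t ^ (1 - q) * (signedPow q (f t) * signedPow q (w θ)))
    {t₀ : ℝ} (ht₀ : t₀ ∈ I) (hft₀ : f t₀ ≠ 0) {a b : ℝ} (hab : w a ≠ w b) :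
    ∃ c, c ≠ 0 ∧ ∀ t ∈ I, f t = c * p t := by
  obtain ⟨x, y, hx, hy, hxy⟩ : ∃ x y, w x ≠ 0 ∧ w y ≠ 0 ∧ |w x| ≠ |w y| := by
    rcases lt_or_gt_of_ne hab with h | h <;> exact exists_abs_ne_of_continuous hw h
  have hq0 : q - 1 ≠ 0 := sub_ne_zero.2 hq1
  have hdet : signedPow q (w x) * w y - signedPow q (w y) * w x ≠ 0 := by
    have : signedPow q (w x) * w y - signedPow q (w y) * w x =
        w x * w y * (|w x| ^ (q - 1) - |w y| ^ (q - 1)) := by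
      simp only [signedPow]; ring
    rw [this]
    refine mul_ne_zero (mul_ne_zero hx hy) (sub_ne_zero.2 fun h => hxy ?_)
    exact rpow_injective_of_ne (abs_pos.2 hx) (abs_pos.2 hy) hq0 h
  set d := signedPow q (w x) * w y - signedPow q (w y) * w x with hd
  have hlin : ∀ t ∈ I, f t ≠ 0 →
      (|f t| / p t) ^ (q - 1) = (w₂ x * w y - w₂ y * w x) / (ε * d) := by
    intro t ht hft
    have hpt := hp t ht
    have h : f t * (w₂ x * w y - w₂ y * w x) = ε * p t ^ (1 - q) * signedPow q (f t) * d := by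
      rw [hd]
      linear_combination w y * heq t ht x - w x * heq t ht y
    rw [Real.div_rpow (abs_nonneg _) hpt.le, eq_div_iff (mul_ne_zero hε hdet)]
    have h2 : p t ^ (1 - q) = (p t ^ (q - 1))⁻¹ := by
      rw [← Real.rpow_neg hpt.le]; congr 1; ring
    rw [h2, signedPow] at h
    have h3 := Real.rpow_pos_of_pos hpt (q - 1)
    refine mul_left_cancel₀ hft ?_
    rw [h]
    field_simp
  set y₀ := |f t₀| / p t₀ with hy₀
  have hy₀pos : 0 < y₀ := div_pos (abs_pos.2 hft₀) (hp t₀ ht₀)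
  have hval : ∀ t ∈ I, f t / p t ∈ ({0, y₀, -y₀} : Set ℝ) := by
    intro t ht
    have hpt := hp t ht
    by_cases hft : f t = 0
    · simp [hft]
    · have : |f t| / p t = y₀ :=
        rpow_injective_of_ne (div_pos (abs_pos.2 hft) hpt) hy₀pos hq0
          ((hlin t ht hft).trans (hlin t₀ ht₀ hft₀).symm)
      rcases abs_choice (f t) with h | h
      · rw [h] at this; simp [this]
      · rw [h, neg_div] at this
        have : f t / p t = -y₀ := by linarith
        simp [this]
  have hfin : ({0, y₀, -y₀} : Set ℝ).Finite := by simp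
  have hconst : ∀ t ∈ I, f t / p t = f t₀ / p t₀ := fun t ht =>
    hI.constant_of_mapsTo (hfin.isDiscrete) (hf.div hpc fun t ht => (hp t ht).ne') hval ht ht₀
  refine ⟨f t₀ / p t₀, div_ne_zero hft₀ (hp t₀ ht₀).ne', fun t ht => ?_⟩
  rw [← hconst t ht, div_mul_cancel₀ _ (hp t ht).ne']

theorem contDiff_polar_angle (r : ℝ) : ContDiff ℝ 2 fun θ => polar r θ := by
  simp only [polar_eq]
  fun_prop

theorem deriv_deriv_affine_eq_zero {I : Set ℝ} (hI : IsOpen I) {f : ℝ → ℝ} {c M N : ℝ}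
    (hf : ∀ t ∈ I, f t = c * (M + N * t)) {t : ℝ} (ht : t ∈ I) : deriv (deriv f) t = 0 := by
  have h1 : f =ᶠ[𝓝 t] fun t => c * (M + N * t) := by
    filter_upwards [hI.mem_nhds ht] with s hs using hf s hs
  have h2 : deriv (fun t : ℝ => c * (M + N * t)) = fun _ => c * N := funext fun s => by
    have : HasDerivAt (fun t : ℝ => c * (M + N * t)) (c * (N * 1)) s :=
      (((hasDerivAt_id s).const_mul N).const_add M).const_mul c
    simp [this.deriv]
  rw [h1.deriv.deriv_eq, h2, deriv_const]

/-- This is where the weight exponent `1 - q` matters: it leaves exactly one factor `p`, to be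
cancelled against the one in `f = c p`. -/
theorem rhs_homogeneous {q p c z : ℝ} (hp : 0 < p) :
    p ^ (1 - q) * (signedPow q (c * p) * signedPow q z) = p * signedPow q (c * z) := by
  have h : p ^ (1 - q) * p ^ q = p := by
    rw [← Real.rpow_add hp, sub_add_cancel, Real.rpow_one]
  rw [signedPow_mul, signedPow_mul, signedPow_of_pos hp]
  linear_combination signedPow q c * signedPow q z * h

/-! ### Reduction to the angular equation and back -/

/-- The logarithmic radial interval. -/
def logInterval (R₁ : ℝ) (R₂ : EReal) : Set ℝ :=
  {t | R₁ < Real.exp t ∧ ((Real.exp t : ℝ) : EReal) < R₂}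

theorem isOpen_logInterval (R₁ : ℝ) (R₂ : EReal) : IsOpen (logInterval R₁ R₂) :=
  (isOpen_lt continuous_const Real.continuous_exp).inter
    (isOpen_lt (continuous_coe_real_ereal.comp Real.continuous_exp) continuous_const)

theorem isPreconnected_logInterval (R₁ : ℝ) (R₂ : EReal) :
    IsPreconnected (logInterval R₁ R₂) := by
  refine OrdConnected.isPreconnected ⟨fun x hx y hy z hz => ⟨?_, ?_⟩⟩
  · exact hx.1.trans_le (Real.exp_le_exp.2 hz.1)
  · exact lt_of_le_of_lt (EReal.coe_le_coe_iff.2 (Real.exp_le_exp.2 hz.2)) hy.2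

/-- The logarithmic polar form of the equation, for `u = f(log r) w(θ)`. -/
theorem separated_equation {R₁ : ℝ} {R₂ : EReal} (h0 : 0 ≤ R₁) {M N ε q : ℝ} {u : Plane → ℝ}
    (hu : IsSolution R₁ R₂ M N ε q u) {f w : ℝ → ℝ}
    (hfw : ∀ t ∈ logInterval R₁ R₂, ∀ θ, u (polar (Real.exp t) θ) = f t * w θ)
    {t : ℝ} (ht : t ∈ logInterval R₁ R₂) (θ : ℝ) :
    deriv (deriv f) t * w θ + f t * deriv (deriv w) θ =
      ε * (M + N * t) ^ (1 - q) * (signedPow q (f t) * signedPow q (w θ)) := by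
  have hmem := polar_mem_annulus h0 ht.1 ht.2 θ
  have hc : ContDiffAt ℝ 2 u (polar (Real.exp t) θ) :=
    hu.1.contDiffAt ((isOpen_annulus R₁ R₂).mem_nhds hmem)
  have hlap := laplacian_logPolar hc
  have e1 : deriv (deriv fun t => u (polar (Real.exp t) θ)) t = deriv (deriv f) t * w θ := by
    have h1 : (fun t => u (polar (Real.exp t) θ)) =ᶠ[𝓝 t] fun t => f t * w θ := by
      filter_upwards [(isOpen_logInterval R₁ R₂).mem_nhds ht] with s hs using hfw s hs θ
    -- Constants pull out of `deriv` without any differentiability assumption, so no regularity of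
    -- `f` or `w` is needed here.
    have h2 : deriv (fun t => f t * w θ) = fun t => deriv f t * w θ :=
      funext fun s => deriv_mul_const_field _
    rw [h1.deriv.deriv_eq, h2, deriv_mul_const_field]
  have e2 : deriv (deriv fun θ => u (polar (Real.exp t) θ)) θ = f t * deriv (deriv w) θ := by
    have h2 : deriv (fun θ => f t * w θ) = fun θ => f t * deriv w θ :=
      funext fun s => deriv_const_mul_field _
    rw [funext fun θ => hfw t ht θ, h2, deriv_const_mul_field]
  rw [e1, e2, hu.2 _ hmem, norm_polar (Real.exp_pos t).le, Real.log_exp] at hlap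
  rw [hlap, ← signedPow_mul, ← hfw t ht θ, signedPow]
  have := Real.exp_pos t
  field_simp

/-- A non-radial pseudo-radial solution is `(M + N log r) W(θ)` for an angular solution `W`. -/
theorem exists_angular_of_not_isRadial {R₁ : ℝ} {R₂ : EReal} (h0 : 0 ≤ R₁) {M N ε q : ℝ}
    (hq1 : q ≠ 1) (hε : ε ≠ 0)
    (hpos : ∀ r : ℝ, R₁ < r → (r : EReal) < R₂ → 0 < M + N * Real.log r) {u : Plane → ℝ}
    (hu : IsSolution R₁ R₂ M N ε q u) (hps : IsPseudoRadial R₁ R₂ u)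
    (hnr : ¬ IsRadial R₁ R₂ u) :
    ∃ W : ℝ → ℝ, IsODESolution 0 ε q W ∧ Function.Periodic W (2 * Real.pi) ∧
      (∃ a b, W a ≠ W b) ∧ ∀ r θ : ℝ, R₁ < r → (r : EReal) < R₂ →
        u (polar r θ) = (M + N * Real.log r) * W θ := by
  obtain ⟨h, w, hwper, hhw⟩ := hps
  simp only [IsRadial, not_forall] at hnr
  obtain ⟨x, hx, y, hy, hxy, huxy⟩ := hnr
  obtain ⟨a, ha⟩ := exists_polar x
  obtain ⟨b, hb⟩ := exists_polar y
  rw [← hxy] at hb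
  obtain ⟨hx1, hx2⟩ := hx
  rw [← ha, ← hb] at huxy
  clear ha hb
  generalize ‖x‖ = r₀ at hx1 hx2 huxy
  have hr₀ : 0 < r₀ := h0.trans_lt hx1
  rw [hhw _ _ hx1 hx2, hhw _ _ hx1 hx2] at huxy
  have hh : h r₀ ≠ 0 := fun hz => huxy (by simp [hz])
  have hab : w a ≠ w b := fun hz => huxy (by rw [hz])
  set I := logInterval R₁ R₂ with hI
  set f : ℝ → ℝ := fun t => h (Real.exp t) with hf
  have hfw : ∀ t ∈ I, ∀ θ, u (polar (Real.exp t) θ) = f t * w θ := fun t ht θ =>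
    hhw _ _ ht.1 ht.2
  have hw : ContDiff ℝ 2 w := by
    -- Regularity of `w` is inherited from `u` on the circle of radius `r₀`, where `h r₀ ≠ 0`.
    have : w = fun θ => (h r₀)⁻¹ * u (polar r₀ θ) := funext fun θ => by
      rw [hhw _ _ hx1 hx2]; field_simp
    rw [this]
    exact contDiff_const.mul (hu.1.comp_contDiff (contDiff_polar_angle r₀) fun θ =>
      polar_mem_annulus h0 hx1 hx2 θ)
  have hfc : ContinuousOn f I := by
    obtain ⟨θ₁, hθ₁⟩ : ∃ θ, w θ ≠ 0 := by
      by_contra! hz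
      exact hab (by rw [hz, hz])
    have h1 : ContinuousOn (fun t => u (polar (Real.exp t) θ₁) / w θ₁) I := by
      refine ContinuousOn.div_const (hu.1.continuousOn.comp ?_ fun t ht =>
        polar_mem_annulus h0 ht.1 ht.2 θ₁) _
      exact fun t _ => (hasDerivAt_polar_exp θ₁ t).continuousAt.continuousWithinAt
    refine h1.congr fun t ht => ?_
    beta_reduce
    rw [hfw t ht]
    field_simp
  have hp : ∀ t ∈ I, 0 < M + N * t := fun t ht => by
    simpa using hpos _ ht.1 ht.2
  have ht₀ : Real.log r₀ ∈ I := by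
    rw [hI, logInterval, mem_ofPred_eq, Real.exp_log hr₀]
    exact ⟨hx1, hx2⟩
  obtain ⟨c, hc, hfp⟩ := radial_factor_of_separation (p := fun t => M + N * t) hq1 hε
    (isPreconnected_logInterval R₁ R₂) hp (by fun_prop) hfc hw.continuous
    (fun t ht θ => separated_equation h0 hu hfw ht θ) ht₀
    (by rw [hf]; beta_reduce; rwa [Real.exp_log hr₀]) hab
  refine ⟨fun θ => c * w θ, ⟨contDiff_const.mul hw, fun θ => ?_⟩, fun θ => by simp only [hwper θ],
    ⟨a, b, fun hz => hab (mul_left_cancel₀ hc hz)⟩, fun r θ h1 h2 => ?_⟩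
  -- One radius suffices for the angular equation: `f = c p` is affine, so the term with `f''`
  -- drops, and `p > 0` can be cancelled.
  · have heq := separated_equation h0 hu hfw ht₀ θ
    have hp₀ := hp _ ht₀
    rw [deriv_deriv_affine_eq_zero (isOpen_logInterval R₁ R₂) hfp ht₀, hfp _ ht₀, mul_assoc ε,
      rhs_homogeneous hp₀] at heq
    have h2 : deriv (fun θ => c * w θ) = fun θ => c * deriv w θ :=
      funext fun s => deriv_const_mul_field _
    rw [h2, deriv_const_mul_field]
    change _ = ε * signedPow q (c * w θ)
    refine mul_left_cancel₀ hp₀.ne' ?_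
    linear_combination heq
  · have hr : 0 < r := h0.trans_lt h1
    have hlog : Real.log r ∈ I := by
      rw [hI, logInterval, mem_ofPred_eq, Real.exp_log hr]
      exact ⟨h1, h2⟩
    have := hfp _ hlog
    rw [hf] at this
    beta_reduce at this
    rw [Real.exp_log hr] at this
    rw [hhw _ _ h1 h2, this]
    ring

theorem isSolution_of_angular {R₁ : ℝ} {R₂ : EReal} (h0 : 0 ≤ R₁) {M N ε q : ℝ}
    (hpos : ∀ r : ℝ, R₁ < r → (r : EReal) < R₂ → 0 < M + N * Real.log r) {u : Plane → ℝ}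
    {W : ℝ → ℝ} (hW : IsODESolution 0 ε q W)
    (hu : ∀ r θ : ℝ, R₁ < r → (r : EReal) < R₂ → u (polar r θ) = (M + N * Real.log r) * W θ) :
    IsSolution R₁ R₂ M N ε q u := by
  have hC := contDiffOn_of_polar h0 hW.1 hu
  refine ⟨hC, fun x hx => ?_⟩
  have hr : 0 < ‖x‖ := h0.trans_lt hx.1
  obtain ⟨θ, hθ⟩ := exists_polar x
  have hc : ContDiffAt ℝ 2 u (polar (Real.exp (Real.log ‖x‖)) θ) := by
    rw [Real.exp_log hr, hθ]
    exact hC.contDiffAt ((isOpen_annulus R₁ R₂).mem_nhds hx)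
  have hlap := laplacian_logPolar hc
  have ht : Real.log ‖x‖ ∈ logInterval R₁ R₂ := by
    rw [logInterval, mem_ofPred_eq, Real.exp_log hr]
    exact hx
  have hut : ∀ t ∈ logInterval R₁ R₂, ∀ θ, u (polar (Real.exp t) θ) = W θ * (M + N * t) :=
    fun t ht θ => by rw [hu _ _ ht.1 ht.2, Real.log_exp, mul_comm]
  have e2 : deriv (deriv fun θ => u (polar (Real.exp (Real.log ‖x‖)) θ)) θ =
      (M + N * Real.log ‖x‖) * (ε * signedPow q (W θ)) := by
    have h2 : deriv (fun θ => W θ * (M + N * Real.log ‖x‖)) =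
        fun θ => deriv W θ * (M + N * Real.log ‖x‖) :=
      funext fun s => deriv_mul_const_field _
    rw [funext fun θ => hut _ ht θ, h2, deriv_mul_const_field]
    have := hW.2 θ
    rw [zero_mul, add_zero] at this
    rw [this, signedPow]
    ring
  rw [deriv_deriv_affine_eq_zero (isOpen_logInterval R₁ R₂) (fun t ht => hut t ht θ) ht, e2,
    Real.exp_log hr, hθ, zero_add] at hlap
  have hp := hpos _ hx.1 hx.2
  have hux : u x = (1 * (M + N * Real.log ‖x‖)) * W θ := by
    rw [one_mul, ← hu _ _ hx.1 hx.2, hθ]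
  have hrhs := rhs_homogeneous (q := q) (c := 1) (z := W θ) hp
  rw [← signedPow_mul, ← hux, one_mul] at hrhs
  change _ = _ * signedPow q (u x)
  rw [mul_assoc, hrhs]
  field_simp
  linarith

end PseudoRadial

end

/-! ### The main theorem -/

theorem theorem4p3 (q : ℝ) (hq₀ : 0 < q) (hq₁ : q ≠ 1) :
    -- `ε = +1`
    (∀ (R₁ : ℝ) (R₂ : EReal) (M N : ℝ), 0 ≤ R₁ → (R₁ : EReal) < R₂ →
      (∀ r : ℝ, R₁ < r → (r : EReal) < R₂ → 0 < M + N * Real.log r) →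
      ∀ u : PseudoRadial.Plane → ℝ,
        PseudoRadial.IsSolution R₁ R₂ M N 1 q u → PseudoRadial.IsPseudoRadial R₁ R₂ u →
          PseudoRadial.IsRadial R₁ R₂ u) ∧
    -- `ε = -1`
    ∃ w : ℕ → ℝ → ℝ,
      -- for each `k ≥ 1`, `w k` is the unique mode `k`, up to sign (and translation)
      (∀ k : ℕ, 1 ≤ k →
        PseudoRadial.IsAngularMode q k (w k) ∧ w k 0 = 0 ∧
        (∀ v : ℝ → ℝ, PseudoRadial.IsAngularMode q k v → v 0 = 0 →
          v = w k ∨ v = -(w k)) ∧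
        (∀ v : ℝ → ℝ, PseudoRadial.IsAngularMode q k v →
          ∃ s φ : ℝ, (s = 1 ∨ s = -1) ∧ ∀ θ, v θ = s * w k (θ - φ))) ∧
      (∀ (R₁ : ℝ) (R₂ : EReal) (M N : ℝ), 0 ≤ R₁ → (R₁ : EReal) < R₂ →
        (∀ r : ℝ, R₁ < r → (r : EReal) < R₂ → 0 < M + N * Real.log r) →
        ∀ u : PseudoRadial.Plane → ℝ,
          -- the non-radial pseudo-radial solutions are exactly the listed functions
          ((PseudoRadial.IsSolution R₁ R₂ M N (-1) q u ∧
              PseudoRadial.IsPseudoRadial R₁ R₂ u ∧ ¬ PseudoRadial.IsRadial R₁ R₂ u) ↔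
            ∃ k : ℕ, 1 ≤ k ∧ PseudoRadial.IsRotatedProfile R₁ R₂ M N (w k) u) ∧
          -- and the integer `k` is determined by the solution
          (∀ j k : ℕ, 1 ≤ j → 1 ≤ k →
            PseudoRadial.IsRotatedProfile R₁ R₂ M N (w j) u →
            PseudoRadial.IsRotatedProfile R₁ R₂ M N (w k) u → j = k)) := by
  obtain ⟨w, hmode, huniq, hclass⟩ := PseudoRadial.exists_angularModes hq₀ hq₁
  refine ⟨fun R₁ R₂ M N h0 _ hpos u hu hps => ?_, w, fun k hk => ⟨(hmode k hk).1, (hmode k hk).2,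
    fun v hv hv0 => ?_, fun v hv => ?_⟩, fun R₁ R₂ M N h0 hR hpos u => ⟨⟨?_, ?_⟩, ?_⟩⟩
  · by_contra hnr
    obtain ⟨W, hW, hper, ⟨a, b, hab⟩, -⟩ := PseudoRadial.exists_angular_of_not_isRadial h0 hq₁
      one_ne_zero hpos hu hps hnr
    exact hab (PseudoRadial.const_of_periodic_pos hq₀ Real.two_pi_pos hW hper a b)
  · obtain ⟨s, hs, h⟩ := huniq k hk v hv 0 hv0
    rcases hs with rfl | rfl
    · exact Or.inl (funext fun θ => by simp [h θ])
    · exact Or.inr (funext fun θ => by simp [h θ])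
  · obtain ⟨φ, hφ⟩ := hv.2.1.exists_eq_zero hv.1.1.continuous
    obtain ⟨s, hs, h⟩ := huniq k hk v hv φ hφ
    exact ⟨s, φ, hs, h⟩
  · rintro ⟨hu, hps, hnr⟩
    obtain ⟨W, hW, hper, ⟨a, b, hab⟩, huW⟩ := PseudoRadial.exists_angular_of_not_isRadial h0
      hq₁ (by norm_num) hpos hu hps hnr
    have hne : ∃ t, W t ≠ 0 := by
      by_contra! hz
      exact hab (by rw [hz, hz])
    obtain ⟨k, hk, s, φ, hs, h⟩ := hclass W hW
      (PseudoRadial.signChanging_of_periodic hq₀ Real.two_pi_pos hW hper hne) hper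
    refine ⟨k, hk, s, φ, hs, fun r θ h1 h2 => ?_⟩
    rw [huW r θ h1 h2, h θ]
    ring
  · rintro ⟨k, hk, s, φ, hs, h⟩
    obtain ⟨hode, hsc, ⟨-, hp⟩, -⟩ := (hmode k hk).1
    have hk0 : (k : ℝ) ≠ 0 := by exact_mod_cast (Nat.one_le_iff_ne_zero.1 hk)
    have hs0 : s ≠ 0 := by rcases hs with rfl | rfl <;> norm_num
    have hper : Function.Periodic (fun θ => s * w k (θ - φ)) (2 * Real.pi) := by
      rw [PseudoRadial.periodic_sign_mul_comp_sub hs fun θ => rfl]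
      have := hp.nat_mul k
      rwa [mul_div_cancel₀ _ hk0] at this
    have huW : ∀ r θ : ℝ, R₁ < r → (r : EReal) < R₂ →
        u (PseudoRadial.polar r θ) = (M + N * Real.log r) * (s * w k (θ - φ)) :=
      fun r θ h1 h2 => by rw [h r θ h1 h2]; ring
    refine ⟨PseudoRadial.isSolution_of_angular h0 hpos
      ((hode.comp_sub hq₀ φ).smul_sign hq₀ hs) huW,
      ⟨fun r => M + N * Real.log r, fun θ => s * w k (θ - φ), hper, huW⟩, fun hrad => ?_⟩
    -- On a circle inside the annulus, `u` takes values of both signs because `w k` does.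
    obtain ⟨r, h1, h2⟩ := EReal.lt_iff_exists_real_btwn.1 hR
    have h1 : R₁ < r := by exact_mod_cast h1
    obtain ⟨⟨a, ha⟩, b, hb⟩ := hsc
    have hab := hrad _ (PseudoRadial.polar_mem_annulus h0 h1 h2 (a + φ)) _
      (PseudoRadial.polar_mem_annulus h0 h1 h2 (b + φ))
      (by rw [PseudoRadial.norm_polar (h0.trans h1.le), PseudoRadial.norm_polar (h0.trans h1.le)])
    rw [h r _ h1 h2, h r _ h1 h2, add_sub_cancel_right, add_sub_cancel_right] at hab
    have := mul_left_cancel₀ (hpos r h1 h2).ne' (mul_left_cancel₀ hs0 hab)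
    linarith
  · rintro j k hj hk ⟨s, φ, hs, h⟩ ⟨s', φ', hs', h'⟩
    obtain ⟨r, h1, h2⟩ := EReal.lt_iff_exists_real_btwn.1 hR
    have h1 : R₁ < r := by exact_mod_cast h1
    have heq : ∀ θ, s * w j (θ - φ) = s' * w k (θ - φ') := fun θ => by
      have := (h r θ h1 h2).symm.trans (h' r θ h1 h2)
      refine mul_left_cancel₀ (hpos r h1 h2).ne' ?_
      linear_combination this
    -- Sign and rotation do not affect the set of periods, so the least periods `2π / j` and `2π /
    -- k` coincide.
    have hiff : ∀ P, Function.Periodic (w j) P ↔ Function.Periodic (w k) P := fun P => by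
      rw [← PseudoRadial.periodic_sign_mul_comp_sub hs fun θ => rfl,
        PseudoRadial.periodic_sign_mul_comp_sub hs' heq]
    have hlj := (hmode j hj).1.2.2
    have hlk := (hmode k hk).1.2.2
    unfold PseudoRadial.HasLeastPeriod at hlj hlk
    simp only [hiff] at hlj
    have hjk := hlj.unique hlk
    have hj0 : (0 : ℝ) < j := by exact_mod_cast hj
    have hk0 : (0 : ℝ) < k := by exact_mod_cast hk
    rw [div_eq_div_iff hj0.ne' hk0.ne'] at hjk
    have := mul_left_cancel₀ Real.two_pi_pos.ne' hjk
    exact_mod_cast this.symm
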